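/- For integers $b_1,\dots,b_m$ let $K_m(b_1,\dots,b_m)$ be the continuant, i.e. the determinant of the tridiagonal $m\times m$ matrix with diagonal entries $b_1,\dots,b_m$ and all entries directly above and below the diagonal equal to $1$ ($K_0=1$). For $n\ge 2$ put $$R_n(a_1,\dots,a_n)=K_n(a_1,\dots,a_n)-K_{n-2}(a_2,\dots,a_{n-1}).$$ Extend $(a_1,\dots,a_n)\in\mathbb Z^n$ to an $n$-periodic sequence $(a_i)_{i\in\mathbb Z}$. A solution of $R_n(a_1,\dots,a_n)=0$ is called totally positive if $K_{j-i+1}(a_i,\dots,a_j)>0$ for all $i\le j$ with $j-i\le n$ (for $n=2$: with $j-i\le 1$). For a triangulation of a convex $N$-gon with vertices labelled $1,\dots,N$ in cyclic order, its quiddity is the $N$-tuple whose $i$-th entry is the number of triangles adjacent to the $i$-th vertex. **Theorem.** Let $n\ge 2$. The totally positive integer solutions of $R_n(a_1,\dots,a_n)=0$ are in bijection with the centrally symmetric triangulations of a $2n$-gon. More precisely: 1. if $(a_1,\dots,a_n)\in\mathbb Z^n$ is a totally positive solution of $R_n=0$, then there is exactly one triangulation of the $2n$-gon with quiddity $(a_1,\dots,a_n,a_1,\dots,a_n)$,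 and this triangulation is centrally symmetric; 2. conversely, the quiddity of every centrally symmetric triangulation of the $2n$-gon is $(a_1,\dots,a_n,a_1,\dots,a_n)$ for exactly one totally positive integer solution $(a_1,\dots,a_n)$ of $R_n=0$. -/

import Mathlib

/-- The continuant `K_m(b₁, …, b_m)`: the determinant of the tridiagonal `m × m` matrix with
diagonal `b₁, …, b_m` and ones directly above and below the diagonal. -/
def continuant {m : ℕ} (b : Fin m → ℤ) : ℤ :=
  Matrix.det (Matrix.of fun i j : Fin m =>
    if i = j then b i
    else if (i : ℕ) + 1 = (j : ℕ) ∨ (j : ℕ) + 1 = (i : ℕ) then 1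
    else 0)

/-- The `m` consecutive entries, starting at position `i`, of the `n`-periodic extension of the
`n`-tuple `a` (positions are numbered from `0`). -/
def window {n : ℕ} (a : Fin n → ℤ) (i : Fin n) (m : ℕ) : Fin m → ℤ :=
  fun k => a ⟨((i : ℕ) + (k : ℕ)) % n, Nat.mod_lt _ i.pos⟩

/-- The rotundus `R_n(a₁, …, a_n) = K_n(a₁, …, a_n) - K_{n-2}(a₂, …, a_{n-1})`, with the usual
conventions `K₀ = 1`, `K₋₁ = 0`, `K₋₂ = -1`. -/
def rotundus : {n : ℕ} → (Fin n → ℤ) → ℤ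
  | 0, _ => 2
  | 1, a => a 0
  | _ + 2, a => continuant a - continuant fun k => a k.succ.castSucc

/-- Total positivity of an `n`-tuple `a`, extended `n`-periodically to `(a_i)`:
`K_{j-i+1}(a_i, …, a_j) > 0` whenever `0 ≤ j - i ≤ n`; here `m = j - i + 1`.
The bound `m ≤ 2 * n - 2` follows from `m ≤ n + 1` if `n ≥ 3`; for `n = 2` it removes the
condition `m = 3`, as `K₃(a₁, a₂, a₁) = K₃(a₂, a₁, a₂) = 0` whenever `a₁ a₂ = 2`. -/
def TotallyPositive {n : ℕ} (a : Fin n → ℤ) : Prop :=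
  ∀ (i : Fin n) (m : ℕ), 1 ≤ m → m ≤ n + 1 → m ≤ 2 * n - 2 → 0 < continuant (window a i m)

/-- A set of chords of a convex `N`-gon, whose vertices are labelled by `Fin N` in cyclic order,
given as a graph on the vertices: no two of the chords cross. Two chords of a convex polygon
cross in their interiors iff their endpoints alternate. -/
def IsNoncrossing {N : ℕ} (G : SimpleGraph (Fin N)) : Prop :=
  ∀ p q r s : Fin N, p < q → q < r → r < s → ¬ (G.Adj p r ∧ G.Adj q s)

/-- A triangulation of a convex `N`-gon (`N ≥ 3`), given as the graph formed by its sides and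
diagonals: it contains all sides of the polygon, no two of its diagonals cross, and no further
diagonal can be added. -/
structure IsTriangulation {N : ℕ} (G : SimpleGraph (Fin N)) : Prop where
  side : ∀ v : Fin N, G.Adj v (finRotate N v)
  noncrossing : IsNoncrossing G
  maximal : ∀ H : SimpleGraph (Fin N), IsNoncrossing H → G ≤ H → H = G

/-- The vertex opposite to `v` in a `2n`-gon, i.e. its image under the central symmetry. -/
def opposite {n : ℕ} (v : Fin (2 * n)) : Fin (2 * n) :=
  ⟨((v : ℕ) + n) % (2 * n), Nat.mod_lt _ v.pos⟩

def IsCentrallySymmetric {n : ℕ} (G : SimpleGraph (Fin (2 * n))) : Prop :=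
  ∀ u v : Fin (2 * n), G.Adj u v ↔ G.Adj (opposite u) (opposite v)

/-- The number of triangles of the triangulation `G` adjacent to each vertex. As the vertices
are in convex position, the triangles of `G` are exactly the triples of vertices that are
pairwise joined in `G`. -/
noncomputable def quiddity {N : ℕ} (G : SimpleGraph (Fin N)) : Fin N → ℤ :=
  fun v => (Set.ncard {t : Finset (Fin N) | G.IsNClique 3 t ∧ v ∈ t} : ℤ)

/-- The doubled tuple `(a₁, …, a_n, a₁, …, a_n)`. -/
def double {n : ℕ} (a : Fin n → ℤ) : Fin (2 * n) → ℤ :=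
  fun v => a ⟨(v : ℕ) % n, Nat.mod_lt _ (by have := v.pos; omega)⟩

/-! ### Continuants and the linear recurrence -/

/-! The proof passes through Conway–Coxeter friezes. Extend `a` to an `n`-periodic sequence `c`.
Continuants of consecutive entries are the 2×2 determinants `frieze c i j` formed from two basic
solutions of `W (k + 2) = c (k + 1) * W (k + 1) - W k`, so they satisfy the Ptolemy relation
(`frieze_ptolemy`). The monodromy `M` over one period has determinant 1 and trace `R_n(a)`
(`rotundus_eq_trace`). By Cayley–Hamilton, `R_n(a) = 0` iff `M² = -1`, i.e. iff the frieze changes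
sign under `j ↦ j + 2n`. Total positivity then makes all entries with `0 < j - i < 2n` positive.

In such a positive integer frieze of a `2n`-gon the entries equal to one are the chords of a
triangulation. They do not cross by Ptolemy, every such chord has a triangle on its inner side by
`exists_frieze_eq_one`, and the triangle counts are `c` by `quiddity_friezeGraph`. Any triangulation
with quiddity `c` has entry one at its chords (`IsTriangulation.frieze_of_adj`), so maximality makes
it this one. It is centrally symmetric since the frieze is invariant under shifting both indices by
`n`.

Conversely, the frieze of the quiddity of a triangulation is positive, and its entries at the
closing side force monodromy `-1` over `2n` steps. Central symmetry makes the quiddity `n`-periodic,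
hence `M² = -1` and the trace vanishes. -/

theorem continuant_fin_zero (b : Fin 0 → ℤ) : continuant b = 1 := by
  simp [continuant]

theorem continuant_fin_one (b : Fin 1 → ℤ) : continuant b = b 0 := by
  simp [continuant]

theorem continuant_succ_succ {m : ℕ} (b : Fin (m + 2) → ℤ) :
    continuant b = b 0 * continuant (fun k : Fin (m + 1) => b k.succ) -
      continuant (fun k : Fin m => b k.succ.succ) := by
  unfold continuant
  rw [Matrix.det_succ_row_zero, Fin.sum_univ_succ, Fin.sum_univ_succ,
    Finset.sum_eq_zero, add_zero]
  -- The minor without row 0 and column 1 has first column `(1, 0, …, 0)`, so one more expansion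
  -- removes it.
  · have h1 : ∀ A : Matrix (Fin (m + 2)) (Fin (m + 2)) ℤ, A 1 0 = 1 →
        (∀ i : Fin m, A i.succ.succ 0 = 0) →
        (A.submatrix Fin.succ (Fin.succAbove 1)).det =
          (A.submatrix (fun i : Fin m => i.succ.succ) (fun i : Fin m => i.succ.succ)).det := by
      intro A h10 h0
      rw [Matrix.det_succ_column_zero, Fin.sum_univ_succ, Finset.sum_eq_zero]
      · simp only [Fin.val_zero, pow_zero, one_mul, add_zero, Matrix.submatrix_apply]
        have e1 : (1 : Fin (m + 2)).succAbove 0 = 0 := rfl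
        rw [e1, show (Fin.succ 0 : Fin (m + 2)) = 1 from rfl, h10, one_mul,
          Matrix.submatrix_submatrix]
        congr 1
      · intro i _
        have e1 : (1 : Fin (m + 2)).succAbove 0 = 0 := rfl
        simp [e1, h0]
    rw [show (Fin.succ 0 : Fin (m + 2)) = 1 from rfl, h1 _ (by simp)
      (by intro i; simp)]
    have e3 : (Fin.succAbove 0 : Fin (m + 1) → Fin (m + 2)) = Fin.succ := by
      funext i; simp
    rw [e3]
    simp only [Fin.val_zero, pow_zero, one_mul, Matrix.of_apply, if_true, Fin.val_one, pow_one]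
    have e4 : (0 : Fin (m + 2)) ≠ 1 := by simp
    simp only [e4, if_false, true_or, if_true, sub_eq_add_neg, neg_mul, one_mul]
    congr 2
    · congr 1
      ext i j
      simp [Fin.ext_iff]
    · congr 1
      ext i j
      simp [Fin.ext_iff]
  · intro i _
    simp [Fin.ext_iff]

/-- The solution of `W (k + 2) = c (k + 1) * W (k + 1) - W k` with initial values `x` and `y`. -/
def recSol (c : ℕ → ℤ) (x y : ℤ) : ℕ → ℤ
  | 0 => x
  | 1 => y
  | k + 2 => c (k + 1) * recSol c x y (k + 1) - recSol c x y k

/-- The frieze of the sequence `c`: for `i < j` its entry at `(i, j)` is the continuant of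
`c (i + 1), …, c (j - 1)`. -/
def frieze (c : ℕ → ℤ) (i j : ℕ) : ℤ :=
  recSol c 1 0 i * recSol c 0 1 j - recSol c 0 1 i * recSol c 1 0 j

section frieze

variable (c : ℕ → ℤ)

theorem frieze_self (i : ℕ) : frieze c i i = 0 := by
  unfold frieze; ring

theorem frieze_swap (i j : ℕ) : frieze c j i = -frieze c i j := by
  unfold frieze; ring

/-- The Plücker relation for 2×2 minors; it holds for any two sequences, whatever recurrence they
satisfy. -/
theorem frieze_ptolemy (i j k l : ℕ) :
    frieze c i k * frieze c j l =
      frieze c i j * frieze c k l + frieze c i l * frieze c j k := by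
  unfold frieze; ring

theorem frieze_right (i j : ℕ) :
    frieze c i (j + 2) = c (j + 1) * frieze c i (j + 1) - frieze c i j := by
  simp only [frieze, recSol]; ring

theorem frieze_left (i j : ℕ) :
    frieze c i j = c (i + 1) * frieze c (i + 1) j - frieze c (i + 2) j := by
  simp only [frieze, recSol]; ring

theorem frieze_succ (i : ℕ) : frieze c i (i + 1) = 1 := by
  induction i with
  | zero => simp [frieze, recSol]
  | succ i ih => rw [frieze_right, frieze_self, frieze_swap, ih]; ring

theorem frieze_succ_succ (i : ℕ) : frieze c i (i + 2) = c (i + 1) := by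
  rw [frieze_right, frieze_succ, frieze_self]; ring

/-- Expanding at the first entry (`continuant_succ_succ`) is the same three-term recurrence as
`frieze_left`. -/
theorem continuant_eq_frieze (m i : ℕ) :
    continuant (fun k : Fin m => c (i + 1 + k)) = frieze c i (i + m + 1) := by
  induction m using Nat.twoStepInduction generalizing i with
  | zero => rw [continuant_fin_zero]; exact (frieze_succ c i).symm
  | one => rw [continuant_fin_one]; simpa using (frieze_succ_succ c i).symm
  | more m ih1 ih2 =>
    rw [continuant_succ_succ, frieze_left]
    have h1 := ih2 (i + 1)
    have h2 := ih1 (i + 2)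
    rw [show i + (m + 2) + 1 = i + 1 + (m + 1) + 1 by ring, ← h1,
      show i + 1 + (m + 1) + 1 = i + 2 + m + 1 by ring, ← h2]
    simp only [Fin.val_succ, Fin.val_zero, add_zero]
    congr 3 <;> funext k <;> congr 1 <;> ring

end frieze

/-! ### Periodic sequences -/

section periodic

variable {c : ℕ → ℤ} {n : ℕ}

/-- By periodicity a shifted solution is again a solution, hence determined by its two initial
values. These coefficients are the entries of the monodromy matrix. -/
theorem recSol_shift (hc : ∀ k, c (k + n) = c k) (x y : ℤ) (k : ℕ) :
    recSol c x y (k + n) =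
      recSol c x y n * recSol c 1 0 k + recSol c x y (n + 1) * recSol c 0 1 k := by
  induction k using Nat.twoStepInduction with
  | zero => simp [recSol]
  | one => simp [recSol, add_comm 1 n]
  | more k ih1 ih2 =>
    have h : recSol c x y (k + 2 + n) =
        c (k + 1) * recSol c x y (k + 1 + n) - recSol c x y (k + n) := by
      rw [show k + 2 + n = (k + n) + 2 by ring, recSol, ← hc (k + 1)]
      congr 3 <;> ring
    rw [h, ih1, ih2]
    simp only [recSol]
    ring

/-- A frieze entry is a determinant and the monodromy has determinant one, which is `frieze_succ c
n`. -/
theorem frieze_shift (hc : ∀ k, c (k + n) = c k) (i j : ℕ) :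
    frieze c (i + n) (j + n) = frieze c i j := by
  have h := frieze_succ c n
  unfold frieze at *
  rw [recSol_shift hc, recSol_shift hc, recSol_shift hc, recSol_shift hc]
  linear_combination
    (recSol c 1 0 i * recSol c 0 1 j - recSol c 0 1 i * recSol c 1 0 j) * h

/-- The trace of the monodromy does not depend on the base point. -/
theorem frieze_trace_eq (hc : ∀ k, c (k + n) = c k) (i : ℕ) :
    frieze c i (i + n + 1) - frieze c (i + 1) (i + n) =
      recSol c 0 1 (n + 1) + recSol c 1 0 n := by
  induction i with
  | zero => simp [frieze, recSol, add_comm]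
  | succ i ih =>
    rw [← ih, frieze_left c i, show i + 1 + n + 1 = i + n + 2 by ring, frieze_right,
      show i + n + 1 = i + 1 + n by ring, hc]
    ring

/-- Cayley–Hamilton: determinant 1 and trace 0 give monodromy with square `-1`. -/
theorem frieze_antiperiodic_of_trace (hc : ∀ k, c (k + n) = c k)
    (htr : recSol c 0 1 (n + 1) + recSol c 1 0 n = 0) (i j : ℕ) :
    frieze c i (j + 2 * n) = -frieze c i j := by
  have h := frieze_succ c n
  unfold frieze at *
  rw [show j + 2 * n = (j + n) + n by ring, recSol_shift hc 0 1 (j + n),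
    recSol_shift hc 1 0 (j + n), recSol_shift hc 0 1 j, recSol_shift hc 1 0 j]
  have hV : recSol c 1 0 n = - recSol c 0 1 (n + 1) := by linarith
  rw [hV] at h ⊢
  linear_combination
    (-(recSol c 1 0 i * recSol c 0 1 j) + recSol c 0 1 i * recSol c 1 0 j) * h

theorem trace_eq_zero_of_antiperiodic (hc : ∀ k, c (k + n) = c k)
    (h : ∀ i j, frieze c i (j + 2 * n) = -frieze c i j) :
    recSol c 0 1 (n + 1) + recSol c 1 0 n = 0 := by
  have hd := frieze_succ c n
  have h0 := h 0 0
  have h1 := h 0 1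
  unfold frieze at *
  rw [show (0 : ℕ) + 2 * n = n + n by ring, recSol_shift hc 0 1 n] at h0
  rw [show (1 : ℕ) + 2 * n = (n + 1) + n by ring, recSol_shift hc 0 1 (n + 1)] at h1
  simp only [recSol] at h0 h1
  -- `h0` and `h1 + hd` say that the trace annihilates `recSol c 0 1` at `n` and at `n + 1`. By `hd`
  -- these two values generate the unit ideal, so the trace is zero.
  linear_combination -(recSol c 0 1 (n + 1) + recSol c 1 0 n) * hd +
    recSol c 1 0 n * (h1 + hd) - recSol c 1 0 (n + 1) * h0

/-- The three entries next to the closing side fix both basic solutions just before `N`. Running the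
recurrence past `N`, with the determinant for `recSol c 1 0 N`, gives monodromy `-1`. -/
theorem frieze_antiperiodic_of_closing {N : ℕ} (hN : 2 ≤ N) (hc : ∀ k, c (k + N) = c k)
    (h1 : frieze c 0 (N - 1) = 1) (h2 : frieze c 0 (N - 2) = c (N - 1))
    (h3 : frieze c 1 (N - 1) = c 0) (i j : ℕ) :
    frieze c i (j + N) = -frieze c i j := by
  obtain ⟨M, rfl⟩ : ∃ M, N = M + 2 := ⟨N - 2, by omega⟩
  simp only [Nat.add_sub_cancel, show M + 2 - 1 = M + 1 by omega] at h1 h2 h3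
  have hd := frieze_succ c M
  have h0 := hc 0
  have e1 : recSol c 0 1 (M + 2) = 0 := by
    simp only [frieze, recSol] at *; linear_combination c (M + 1) * h1 - h2
  have e2 : recSol c 0 1 (M + 3) = -1 := by
    have : recSol c 0 1 (M + 3) = c (M + 2) * recSol c 0 1 (M + 2) - recSol c 0 1 (M + 1) := rfl
    rw [this, e1]; simp only [frieze, recSol] at h1; linarith
  have u1 : recSol c 0 1 (M + 1) = 1 := by simp only [frieze, recSol] at h1; linarith
  have u0 : recSol c 0 1 M = c (M + 1) := by simp only [frieze, recSol] at h2; linarith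
  have v1 : recSol c 1 0 (M + 1) = -c 0 := by simp only [frieze, recSol] at h3; linarith
  have v2 : recSol c 1 0 (M + 2) = -1 := by
    unfold frieze at hd
    have : recSol c 1 0 (M + 2) = c (M + 1) * recSol c 1 0 (M + 1) - recSol c 1 0 M := rfl
    rw [u1, u0] at hd; rw [this]; linarith
  have v3 : recSol c 1 0 (M + 3) = 0 := by
    have : recSol c 1 0 (M + 3) = c (M + 2) * recSol c 1 0 (M + 2) - recSol c 1 0 (M + 1) := rfl
    rw [this, v1, v2, ← h0]; simp
  unfold frieze
  rw [recSol_shift hc 0 1 j, recSol_shift hc 1 0 j, e1, e2, v2, v3]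
  ring

/-- In an antiperiodic frieze, positivity on one fundamental domain gives positivity everywhere
between the two zero diagonals. -/
theorem frieze_pos_of_antiperiodic {N : ℕ} (h : ∀ i j, frieze c i (j + N) = -frieze c i j)
    (hpos : ∀ i j, i < j → j < N → 0 < frieze c i j) (i j : ℕ) (hij : i < j) (hj : j < i + N) :
    0 < frieze c i j := by
  have hl : ∀ i j, frieze c (i + N) j = -frieze c i j := fun i j => by
    rw [frieze_swap, h, frieze_swap c i j, neg_neg]
  induction i using Nat.strong_induction_on generalizing j with
  | _ i ih =>
    by_cases hi : N ≤ i
    · obtain ⟨i, rfl⟩ := Nat.exists_eq_add_of_le' hi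
      obtain ⟨j, rfl⟩ := Nat.exists_eq_add_of_le' (hi.trans hij.le)
      rw [hl, h, neg_neg]
      exact ih i (by omega) j (by omega) (by omega)
    · by_cases hjN : j < N
      · exact hpos i j hij hjN
      · obtain ⟨j, rfl⟩ := Nat.exists_eq_add_of_le' (not_lt.mp hjN)
        rw [h, ← frieze_swap]
        exact hpos j i (by omega) (by omega)

/-- In an interval with entry one at its ends, some inner point has entry one with both ends. -/
theorem exists_frieze_eq_one {i j : ℕ} (hij : i + 1 < j) (h1 : frieze c i j = 1)
    (hpos : ∀ p q, i ≤ p → p < q → q ≤ j → 0 < frieze c p q) :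
    ∃ k, i < k ∧ k < j ∧ frieze c i k = 1 ∧ frieze c k j = 1 := by
  classical
  -- The inner point is the first `k` whose entry with `i` is at least its entry with `j`; at `l = k
  -- - 1` the opposite strict inequality holds.
  have hex : ∃ k, i ≤ k ∧ frieze c k j ≤ frieze c i k :=
    ⟨j, by omega, by rw [frieze_self, h1]; norm_num⟩
  obtain ⟨hik, hk⟩ := Nat.find_spec hex
  set k := Nat.find hex with hkdef
  have hkj : k ≤ j := Nat.find_min' hex ⟨by omega, by rw [frieze_self, h1]; norm_num⟩
  have hki : k ≠ i := by
    intro h; rw [h, frieze_self, h1] at hk; omega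
  obtain ⟨l, hl⟩ : ∃ l, k = l + 1 := ⟨k - 1, by omega⟩
  have hlt : frieze c i l < frieze c l j := by
    have := Nat.find_min hex (m := l) (by omega)
    push Not at this
    exact this (by omega)
  have hp := frieze_ptolemy c i l (l + 1) j
  rw [frieze_succ, h1] at hp
  rw [hl] at hk hkj hik hki
  have n1 : 0 ≤ frieze c i l := by
    rcases eq_or_lt_of_le (show i ≤ l by omega) with h | h
    · rw [← h, frieze_self]
    · exact (hpos i l le_rfl h (by omega)).le
  have n2 : 0 ≤ frieze c (l + 1) j := by
    rcases eq_or_lt_of_le hkj with h | h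
    · rw [h, frieze_self]
    · exact (hpos _ j (by omega) h le_rfl).le
  -- Ptolemy reads `f(i,k) f(l,j) = f(i,l) f(k,j) + 1`. Equality in `hk` makes `f(i,k)` a divisor of
  -- 1. A strict inequality would force `f(i,l) + f(k,j) ≤ 0`, so `l = i` and `k = j`, against `i +
  -- 1 < j`.
  rcases eq_or_lt_of_le hk with h | h
  · have hlj : l + 1 < j := by
      rcases eq_or_lt_of_le hkj with h' | h'
      · rw [h', frieze_self, h1] at h; omega
      · exact h'
    have hm : frieze c i (l + 1) * (frieze c l j - frieze c i l) = 1 := by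
      rw [h] at hp; linear_combination hp
    have := Int.eq_one_of_mul_eq_one_right (hpos i (l + 1) le_rfl (by omega) hkj).le hm
    exact ⟨l + 1, by omega, hlj, this, h.trans this⟩
  · exfalso
    have e1 : frieze c i l = 0 ∧ frieze c (l + 1) j = 0 := by
      constructor <;> nlinarith
    have hil : i = l := by
      by_contra hne
      have := hpos i l le_rfl (by omega) (by omega)
      omega
    have hlj : l + 1 = j := by
      by_contra hne
      have := hpos (l + 1) j (by omega) (by omega) le_rfl
      omega
    omega

end periodic

/-! ### Triangulations -/

section triangulation

variable {N : ℕ} {G : SimpleGraph (Fin N)}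

theorem IsNoncrossing.not_adj (h : IsNoncrossing G) {p q r s : Fin N} (hpr : G.Adj p r)
    (hqs : G.Adj q s) (hpq : p < q) (hqr : q < r) (hrs : r < s) : False :=
  h p q r s hpq hqr hrs ⟨hpr, hqs⟩

theorem adj_of_val_succ (hside : ∀ v : Fin N, G.Adj v (finRotate N v)) {i j : Fin N}
    (hij : (i : ℕ) + 1 = j) : G.Adj i j := by
  obtain ⟨M, rfl⟩ : ∃ M, N = M + 1 := ⟨N - 1, by omega⟩
  have h := hside i
  have e : finRotate (M + 1) i = j := by
    rw [show i = ⟨i, i.2⟩ from rfl, finRotate_of_lt (by omega)]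
    exact Fin.ext hij
  rwa [e] at h

theorem adj_zero_last (hside : ∀ v : Fin N, G.Adj v (finRotate N v)) {i j : Fin N}
    (hi : (i : ℕ) = 0) (hj : (j : ℕ) + 1 = N) : G.Adj i j := by
  obtain ⟨M, rfl⟩ : ∃ M, N = M + 1 := ⟨N - 1, by omega⟩
  have h := hside j
  have e : finRotate (M + 1) j = i := by
    rw [show j = Fin.last M from Fin.ext (by simpa using hj), finRotate_last]
    exact Fin.ext hi.symm
  rw [e] at h
  exact h.symm

/-- A chord that crosses no chord of a triangulation belongs to the triangulation. -/
theorem IsTriangulation.adj_of_not_crossing (hG : IsTriangulation G) {k j : Fin N} (hkj : k < j)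
    (h : ∀ x y, k < x → x < j → y < k ∨ j < y → ¬G.Adj x y) : G.Adj k j := by
  have key : G ⊔ SimpleGraph.edge k j = G := by
    refine hG.maximal _ ?_ le_sup_left
    rintro p q r s hpq hqr hrs ⟨hpr, hqs⟩
    simp only [SimpleGraph.sup_adj, SimpleGraph.edge_adj] at hpr hqs
    rcases hpr with hpr | ⟨⟨rfl, rfl⟩ | ⟨rfl, rfl⟩, -⟩
    · rcases hqs with hqs | ⟨⟨rfl, rfl⟩ | ⟨rfl, rfl⟩, -⟩
      · exact hG.noncrossing.not_adj hpr hqs hpq hqr hrs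
      · exact h r p hqr hrs (Or.inl hpq) hpr.symm
      · exact absurd hkj (hqr.trans hrs).not_gt
    · rcases hqs with hqs | ⟨⟨rfl, rfl⟩ | ⟨rfl, rfl⟩, -⟩
      · exact h q s hpq hqr (Or.inr hrs) hqs
      · exact absurd hpq (lt_irrefl _)
      · exact absurd hkj (hqr.trans hrs).not_gt
    · exact absurd hkj (hpq.trans hqr).not_gt
  rw [← key]
  simp [SimpleGraph.edge_adj, hkj.ne]

/-- In a triangulation, each chord other than a side is the base of a triangle on either side. -/
theorem IsTriangulation.exists_triangle (hG : IsTriangulation G) {i j : Fin N}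
    (hij : (i : ℕ) + 1 < j) (hadj : G.Adj i j) :
    ∃ k, i < k ∧ k < j ∧ G.Adj i k ∧ G.Adj k j := by
  classical
  -- The apex is the last neighbour of `i` before `j`. A chord crossing `kj` would cross `ij` or
  -- `ik`, or give a later neighbour of `i`.
  let S : Finset (Fin N) := Finset.univ.filter fun k => i < k ∧ k < j ∧ G.Adj i k
  have hS : S.Nonempty := by
    refine ⟨⟨i + 1, by omega⟩, ?_⟩
    simp only [S, Finset.mem_filter, Finset.mem_univ, true_and]
    exact ⟨Fin.lt_def.2 (by simp), Fin.lt_def.2 hij, adj_of_val_succ hG.side rfl⟩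
  obtain ⟨k, hk, hmax⟩ := S.exists_max_image id hS
  simp only [S, Finset.mem_filter, Finset.mem_univ, true_and, id] at hk hmax
  obtain ⟨hik, hkj, hadjk⟩ := hk
  refine ⟨k, hik, hkj, hadjk, hG.adj_of_not_crossing hkj ?_⟩
  rintro x y hkx hxj (hy | hy) hxy
  · rcases lt_trichotomy y i with h | rfl | h
    · exact hG.noncrossing.not_adj hxy.symm hadj h (hik.trans hkx) hxj
    · exact absurd (hmax x ⟨hik.trans hkx, hxj, hxy.symm⟩) hkx.not_ge
    · exact hG.noncrossing.not_adj hadjk hxy.symm h hy hkx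
  · exact hG.noncrossing.not_adj hadj hxy (hik.trans hkx) hxj hy

/-- Descend from the side joining the first and last vertices: a further chord between `i` and `j`
either lies on one side of the apex `k`, or passes over `k` and crosses `ik` or `kj` unless it is
`ij` itself. -/
theorem isTriangulation_of_exists_triangle (hside : ∀ v : Fin N, G.Adj v (finRotate N v))
    (hnc : IsNoncrossing G)
    (hmid : ∀ i j : Fin N, (i : ℕ) + 1 < j → G.Adj i j →
      ∃ k, i < k ∧ k < j ∧ G.Adj i k ∧ G.Adj k j) : IsTriangulation G := by
  refine ⟨hside, hnc, fun H hH hle => ?_⟩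
  have key : ∀ d : ℕ, ∀ i j p r : Fin N, (j : ℕ) - i = d → G.Adj i j → i ≤ p → p < r → r ≤ j →
      H.Adj p r → G.Adj p r := by
    intro d
    induction d using Nat.strong_induction_on with
    | _ d ih =>
      intro i j p r hd hij hip hpr hrj hadj
      by_cases hlen : (i : ℕ) + 1 < j
      · obtain ⟨k, hik, hkj, hGik, hGkj⟩ := hmid i j hlen hij
        by_cases hrk : r ≤ k
        · exact ih (k - i) (by omega) i k p r rfl hGik hip hpr hrk hadj
        by_cases hkp : k ≤ p
        · exact ih (j - k) (by omega) k j p r rfl hGkj hkp hpr hrj hadj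
        push Not at hrk hkp
        rcases hip.eq_or_lt with rfl | hip
        · rcases hrj.eq_or_lt with rfl | hrj
          · exact hij
          · exact (hH.not_adj hadj (hle hGkj) hkp hrk hrj).elim
        · exact (hH.not_adj (hle hGik) hadj hip hkp hrk).elim
      · have h1 : p = i := by omega
        have h2 : r = j := by omega
        rwa [h1, h2]
  refine le_antisymm (fun u v huv => ?_) hle
  have hu := u.2
  have h0 : G.Adj ⟨0, by omega⟩ ⟨N - 1, by omega⟩ :=
    adj_zero_last hside rfl (by simp only; omega)
  rcases lt_or_gt_of_ne huv.ne with h | h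
  · exact key _ _ _ u v rfl h0 (Fin.le_def.2 (by simp)) h (Fin.le_def.2 (by simp; omega)) huv
  · exact (key _ _ _ v u rfl h0 (Fin.le_def.2 (by simp)) h (Fin.le_def.2 (by simp; omega))
      huv.symm).symm

/-! ### Counting triangles in a part of the polygon -/

open Classical in
/-- The triangles at `v` all of whose vertices lie between `i` and `j`. -/
noncomputable def trianglesIn (G : SimpleGraph (Fin N)) (i j v : Fin N) :
    Finset (Finset (Fin N)) :=
  Finset.univ.filter fun t => G.IsNClique 3 t ∧ v ∈ t ∧ ∀ x ∈ t, i ≤ x ∧ x ≤ j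

theorem mem_trianglesIn {i j v : Fin N} {t : Finset (Fin N)} :
    t ∈ trianglesIn G i j v ↔ G.IsNClique 3 t ∧ v ∈ t ∧ ∀ x ∈ t, i ≤ x ∧ x ≤ j := by
  simp [trianglesIn]

theorem quiddity_eq_card {i j : Fin N} (hi : (i : ℕ) = 0) (hj : (j : ℕ) + 1 = N) (v : Fin N) :
    quiddity G v = (trianglesIn G i j v).card := by
  unfold quiddity
  rw [← Set.ncard_coe_finset]
  congr 2
  ext t
  simp only [Set.mem_ofPred_eq, Finset.mem_coe, mem_trianglesIn]
  refine ⟨fun h => ⟨h.1, h.2, fun x _ => ?_⟩, fun h => ⟨h.1, h.2.1⟩⟩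
  constructor <;> rw [Fin.le_def] <;> omega

theorem trianglesIn_of_notMem {i j v : Fin N} (h : v < i ∨ j < v) :
    trianglesIn G i j v = ∅ := by
  refine Finset.eq_empty_of_forall_notMem fun t ht => ?_
  obtain ⟨-, hv, hx⟩ := mem_trianglesIn.1 ht
  have := hx v hv
  rcases h with h | h
  · exact this.1.not_gt h
  · exact this.2.not_gt h

theorem trianglesIn_of_val_succ {i j v : Fin N} (hij : (i : ℕ) + 1 = j) :
    trianglesIn G i j v = ∅ := by
  refine Finset.eq_empty_of_forall_notMem fun t ht => ?_
  obtain ⟨hc, -, hx⟩ := mem_trianglesIn.1 ht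
  have hsub : t ⊆ {i, j} := fun x hxt => by
    have := hx x hxt
    rw [Fin.le_def, Fin.le_def] at this
    simp only [Finset.mem_insert, Finset.mem_singleton, Fin.ext_iff]
    omega
  have := (Finset.card_le_card hsub).trans Finset.card_le_two
  rw [hc.card_eq] at this
  omega

/-- All triangles at a vertex that is cut off by a chord lie on the same side of the chord. -/
theorem quiddity_eq_card_of_adj (hnc : IsNoncrossing G) {i j v : Fin N} (hadj : G.Adj i j)
    (hiv : i < v) (hvj : v < j) : quiddity G v = (trianglesIn G i j v).card := by
  unfold quiddity
  rw [← Set.ncard_coe_finset]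
  congr 2
  ext t
  simp only [Set.mem_ofPred_eq, Finset.mem_coe, mem_trianglesIn]
  refine ⟨fun h => ⟨h.1, h.2, fun x hx => ?_⟩, fun h => ⟨h.1, h.2.1⟩⟩
  by_contra hcon
  have hne : v ≠ x := by
    rintro rfl
    exact hcon ⟨hiv.le, hvj.le⟩
  have hvx : G.Adj v x := h.1.isClique h.2 hx hne
  rw [not_and_or, not_le, not_le] at hcon
  rcases hcon with hcon | hcon
  · exact hnc.not_adj hvx.symm hadj hcon hiv hvj
  · exact hnc.not_adj hadj hvx hiv hvj hcon

/-- A triangle with vertices on both sides of `k` has an edge passing over `k`; not crossing `ik` or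
`kj`, that edge must be `ij`, so the triangle is `ikj`. -/
theorem card_trianglesIn (hnc : IsNoncrossing G) {i k j : Fin N} (hik : i < k) (hkj : k < j)
    (hGik : G.Adj i k) (hGkj : G.Adj k j) (hGij : G.Adj i j) (v : Fin N) :
    (trianglesIn G i j v).card = (trianglesIn G i k v).card + (trianglesIn G k j v).card +
      if v = i ∨ v = k ∨ v = j then 1 else 0 := by
  classical
  have hcl : G.IsNClique 3 {i, k, j} := SimpleGraph.is3Clique_triple_iff.2 ⟨hGik, hGij, hGkj⟩
  have hunion : trianglesIn G i j v = trianglesIn G i k v ∪ trianglesIn G k j v ∪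
      if v = i ∨ v = k ∨ v = j then {{i, k, j}} else ∅ := by
    ext t
    simp only [Finset.mem_union, mem_trianglesIn]
    constructor
    · rintro ⟨hc, hv, hx⟩
      by_cases h1 : ∀ x ∈ t, x ≤ k
      · exact Or.inl (Or.inl ⟨hc, hv, fun x h => ⟨(hx x h).1, h1 x h⟩⟩)
      by_cases h2 : ∀ x ∈ t, k ≤ x
      · exact Or.inl (Or.inr ⟨hc, hv, fun x h => ⟨h2 x h, (hx x h).2⟩⟩)
      push Not at h1 h2
      obtain ⟨y, hyt, hky⟩ := h1
      obtain ⟨x, hxt, hxk⟩ := h2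
      have hends : ∀ x ∈ t, ∀ y ∈ t, x < k → k < y → x = i ∧ y = j := by
        intro x hxt y hyt hxk hky
        have hadj : G.Adj x y := hc.isClique hxt hyt (hxk.trans hky).ne
        constructor
        · by_contra hne
          exact hnc.not_adj hGik hadj (lt_of_le_of_ne (hx x hxt).1 (Ne.symm hne)) hxk hky
        · by_contra hne
          exact hnc.not_adj hadj hGkj hxk hky (lt_of_le_of_ne (hx y hyt).2 hne)
      have hsub : t ⊆ {i, k, j} := by
        intro z hz
        simp only [Finset.mem_insert, Finset.mem_singleton]
        rcases lt_trichotomy z k with h | h | h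
        · exact Or.inl (hends z hz y hyt h hky).1
        · exact Or.inr (Or.inl h)
        · exact Or.inr (Or.inr (hends x hxt z hz hxk h).2)
      have heq : t = {i, k, j} :=
        Finset.eq_of_subset_of_card_le hsub (by rw [hc.card_eq, hcl.card_eq])
      have hv' : v = i ∨ v = k ∨ v = j := by simpa [heq] using hv
      right
      rw [if_pos hv', heq]
      exact Finset.mem_singleton_self _
    · rintro ((⟨hc, hv, hx⟩ | ⟨hc, hv, hx⟩) | h)
      · exact ⟨hc, hv, fun x h => ⟨(hx x h).1, (hx x h).2.trans hkj.le⟩⟩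
      · exact ⟨hc, hv, fun x h => ⟨hik.le.trans (hx x h).1, (hx x h).2⟩⟩
      · split_ifs at h with hv
        · rw [Finset.mem_singleton] at h
          subst h
          refine ⟨hcl, by simpa using hv, ?_⟩
          simp [hik.le, hkj.le, (hik.trans hkj).le]
        · simp at h
  have hd1 : Disjoint (trianglesIn G i k v) (trianglesIn G k j v) := by
    rw [Finset.disjoint_left]
    intro t h1 h2
    obtain ⟨hc, -, hx1⟩ := mem_trianglesIn.1 h1
    obtain ⟨-, -, hx2⟩ := mem_trianglesIn.1 h2
    have hsub : t ⊆ {k} := fun x hx =>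
      Finset.mem_singleton.2 (le_antisymm (hx1 x hx).2 (hx2 x hx).1)
    have := Finset.card_le_card hsub
    rw [hc.card_eq, Finset.card_singleton] at this
    omega
  have hd2 : Disjoint (trianglesIn G i k v ∪ trianglesIn G k j v)
      (if v = i ∨ v = k ∨ v = j then {{i, k, j}} else ∅) := by
    split_ifs
    · rw [Finset.disjoint_singleton_right, Finset.mem_union]
      rintro (h | h)
      · exact ((mem_trianglesIn.1 h).2.2 j (by simp)).2.not_gt hkj
      · exact ((mem_trianglesIn.1 h).2.2 i (by simp)).1.not_gt hik
    · exact Finset.disjoint_empty_right _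
  rw [hunion, Finset.card_union_of_disjoint hd2, Finset.card_union_of_disjoint hd1]
  split_ifs <;> simp

/-! ### Triangulations and friezes -/

/-- The frieze of the quiddity of a triangulation has entry one at each chord. -/
theorem IsTriangulation.frieze_of_adj (hG : IsTriangulation G) {c : ℕ → ℤ}
    (hc : ∀ v : Fin N, c v = quiddity G v) {i j : Fin N} (hij : i < j) (hadj : G.Adj i j) :
    frieze c i j = 1 ∧ frieze c i (j - 1 : ℕ) = (trianglesIn G i j j).card ∧
      frieze c (i + 1) j = (trianglesIn G i j i).card := by
  obtain ⟨d, hd⟩ : ∃ d : ℕ, (j : ℕ) - i = d := ⟨_, rfl⟩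
  induction d using Nat.strong_induction_on generalizing i j with
  | _ d ih =>
    by_cases hlen : (i : ℕ) + 1 < j
    · obtain ⟨k, hik, hkj, hGik, hGkj⟩ := hG.exists_triangle hlen hadj
      obtain ⟨a1, a2, a3⟩ := ih (k - i) (by omega) hik hGik rfl
      obtain ⟨b1, b2, b3⟩ := ih (j - k) (by omega) hkj hGkj rfl
      have hcard := card_trianglesIn hG.noncrossing hik hkj hGik hGkj hadj
      have hck : c k = (trianglesIn G i k k).card + (trianglesIn G k j k).card + 1 := by
        rw [hc, quiddity_eq_card_of_adj hG.noncrossing hadj hik hkj, hcard]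
        simp
      have ti : (trianglesIn G i j i).card = (trianglesIn G i k i).card + 1 := by
        rw [hcard, trianglesIn_of_notMem (Or.inl hik)]; simp
      have tj : (trianglesIn G i j j).card = (trianglesIn G k j j).card + 1 := by
        rw [hcard, trianglesIn_of_notMem (i := i) (Or.inr hkj)]; simp
      have hik' : (i : ℕ) < k := hik
      have hkj' : (k : ℕ) < j := hkj
      obtain ⟨l, hl⟩ : ∃ l, (k : ℕ) = l + 1 := ⟨k - 1, by omega⟩
      obtain ⟨m, hm⟩ : ∃ m, (j : ℕ) = m + 1 := ⟨j - 1, by omega⟩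
      rw [ti, tj]
      rw [hl] at hck a1 a2 a3 b1 b2 b3
      rw [hm] at b1 b2 b3 ⊢
      simp only [Nat.add_sub_cancel] at a2 b2 ⊢
      push_cast
      have r1 := frieze_right c i l
      have r2 := frieze_right c (i + 1) l
      rw [hck] at r1 r2
      rw [a1, a2] at r1
      -- Here `k = l + 1` and `j = m + 1`. As `c k` is the sum of the counts at `k` in both parts
      -- plus one, `r1` gives `f(i,k+1) = f(k+1,j) + 1`; comparing with Ptolemy for `i, k, k+1, j`
      -- leaves `f(i,j) = 1`.
      have p1 := frieze_ptolemy c i (l + 1) (l + 2) (m + 1)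
      have p2 := frieze_ptolemy c i (l + 1) (l + 2) m
      have p3 := frieze_ptolemy c (i + 1) (l + 1) (l + 2) (m + 1)
      have q1 := frieze_ptolemy c (l + 1) (l + 2) m (m + 1)
      have q2 := frieze_ptolemy c i (i + 1) l (l + 1)
      have s1 := frieze_succ c (l + 1)
      have s2 := frieze_succ c m
      have s3 := frieze_succ c i
      have s4 := frieze_succ c l
      rw [show l + 1 + 1 = l + 2 from rfl] at *
      rw [s1] at p1 p2 p3 q1
      rw [s2, b1, b2, b3] at q1
      rw [s3, s4, a1, a2, a3] at q2
      rw [r1, a1, b1, b3] at p1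
      rw [r1, a1, b2] at p2
      rw [r2, a3, b1, b3] at p3
      refine ⟨by linarith, by linarith, by linarith⟩
    · have hj : (j : ℕ) = i + 1 := by
        have : (i : ℕ) < j := hij
        omega
      rw [trianglesIn_of_val_succ hj.symm, trianglesIn_of_val_succ hj.symm, hj]
      simp [frieze_succ, frieze_self]

/-- Induction over the triangles: with unit entries on `i, k, j`, Ptolemy gives `f(i,r) = f(k,r) +
f(r,j)` for `k < r < j`, and then writes `f(p,r)` for `i < p < k < r` as a sum of products of
positive entries. -/
theorem IsTriangulation.frieze_pos (hG : IsTriangulation G) {c : ℕ → ℤ}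
    (hc : ∀ v : Fin N, c v = quiddity G v) {p r : ℕ} (hpr : p < r) (hr : r < N) :
    0 < frieze c p r := by
  have key : ∀ d : ℕ, ∀ i j : Fin N, (j : ℕ) - i = d → G.Adj i j → ∀ p r : ℕ, i ≤ p → p < r →
      r ≤ j → 0 < frieze c p r := by
    intro d
    induction d using Nat.strong_induction_on with
    | _ d ih =>
      intro i j hd hadj p r hip hpr hrj
      have hij : i < j := Fin.lt_def.2 (by omega)
      have h1 := (hG.frieze_of_adj hc hij hadj).1
      by_cases hlen : (i : ℕ) + 1 < j
      · obtain ⟨k, hik, hkj, hGik, hGkj⟩ := hG.exists_triangle hlen hadj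
        have a1 := (hG.frieze_of_adj hc hik hGik).1
        have b1 := (hG.frieze_of_adj hc hkj hGkj).1
        have ih1 := ih (k - i) (by omega) i k rfl hGik
        have ih2 := ih (j - k) (by omega) k j rfl hGkj
        have hik' : (i : ℕ) < k := hik
        have hkj' : (k : ℕ) < j := hkj
        by_cases hrk : r ≤ k
        · exact ih1 p r hip hpr hrk
        by_cases hkp : (k : ℕ) ≤ p
        · exact ih2 p r hkp hpr hrj
        push Not at hrk hkp
        have hir : 0 < frieze c i r := by
          rcases hrj.eq_or_lt with rfl | hrj
          · rw [h1]; norm_num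
          · have hp := frieze_ptolemy c i k r j
            rw [a1, b1, h1] at hp
            have := ih2 k r le_rfl hrk hrj.le
            have := ih2 r j hrk.le hrj le_rfl
            linarith
        rcases hip.eq_or_lt with rfl | hip
        · exact hir
        · have hp := frieze_ptolemy c i p k r
          rw [a1] at hp
          have := mul_pos (ih1 i p le_rfl hip hkp.le) (ih2 k r le_rfl hrk hrj)
          have := mul_pos hir (ih1 p k hip.le hkp le_rfl)
          linarith
      · have h1 : p = i := by omega
        have h2 : r = i + 1 := by omega
        rw [h1, h2, frieze_succ]; norm_num
  exact key _ ⟨0, by omega⟩ ⟨N - 1, by omega⟩ rfl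
    (adj_zero_last hG.side rfl (by simp only; omega)) p r (Nat.zero_le _) hpr
    (by simp only; omega)

/-- The graph of the entries one of a frieze. -/
def friezeGraph (c : ℕ → ℤ) (N : ℕ) : SimpleGraph (Fin N) where
  Adj u v := |frieze c u v| = 1
  symm := ⟨fun u v h => by rw [frieze_swap, abs_neg]; exact h⟩
  loopless := ⟨fun u h => by simp [frieze_self] at h⟩

theorem friezeGraph_adj_iff {c : ℕ → ℤ} {u v : Fin N} :
    (friezeGraph c N).Adj u v ↔ |frieze c u v| = 1 := Iff.rfl

theorem friezeGraph_adj_iff_of_lt {c : ℕ → ℤ}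
    (hpos : ∀ i j, i < j → j < N → 0 < frieze c i j) {u v : Fin N} (huv : u < v) :
    (friezeGraph c N).Adj u v ↔ frieze c u v = 1 := by
  rw [friezeGraph_adj_iff, abs_of_pos (hpos u v huv v.2)]

/-- For crossing chords Ptolemy would write 1 as a sum of two positive integers. -/
theorem isNoncrossing_friezeGraph {c : ℕ → ℤ}
    (hpos : ∀ i j, i < j → j < N → 0 < frieze c i j) : IsNoncrossing (friezeGraph c N) := by
  rintro p q r s hpq hqr hrs ⟨h1, h2⟩
  rw [friezeGraph_adj_iff_of_lt hpos (hpq.trans hqr)] at h1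
  rw [friezeGraph_adj_iff_of_lt hpos (hqr.trans hrs)] at h2
  have hp := frieze_ptolemy c p q r s
  rw [h1, h2] at hp
  have := mul_pos (hpos p q hpq q.2) (hpos r s hrs s.2)
  have := mul_pos (hpos p s (hpq.trans (hqr.trans hrs)) s.2) (hpos q r hqr r.2)
  omega

/-- This carries uniqueness: the right-hand side depends on the quiddity alone. -/
theorem IsTriangulation.eq_friezeGraph (hG : IsTriangulation G) {c : ℕ → ℤ}
    (hc : ∀ v : Fin N, c v = quiddity G v) : G = friezeGraph c N := by
  have hpos : ∀ i j, i < j → j < N → 0 < frieze c i j := fun i j => hG.frieze_pos hc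
  refine (hG.maximal _ (isNoncrossing_friezeGraph hpos) fun u v huv => ?_).symm
  rcases lt_or_gt_of_ne huv.ne with h | h
  · exact (friezeGraph_adj_iff_of_lt hpos h).2 (hG.frieze_of_adj hc h huv).1
  · exact ((friezeGraph_adj_iff_of_lt hpos h).2 (hG.frieze_of_adj hc h huv.symm).1).symm

theorem isTriangulation_friezeGraph (hN : 2 ≤ N) {c : ℕ → ℤ}
    (hpos : ∀ i j, i < j → j < N → 0 < frieze c i j) (h1 : frieze c 0 (N - 1) = 1) :
    IsTriangulation (friezeGraph c N) := by
  refine isTriangulation_of_exists_triangle ?_ (isNoncrossing_friezeGraph hpos) ?_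
  · obtain ⟨M, rfl⟩ : ∃ M, N = M + 1 := ⟨N - 1, by omega⟩
    intro v
    rw [friezeGraph_adj_iff]
    rcases (Nat.lt_succ_iff.1 v.2).eq_or_lt with h | h
    · rw [show v = Fin.last M from Fin.ext h, finRotate_last, frieze_swap, abs_neg]
      simpa using congrArg abs h1
    · rw [show finRotate (M + 1) v = ⟨v + 1, by omega⟩ from finRotate_of_lt h, frieze_succ]
      simp
  · intro i j hij hadj
    rw [friezeGraph_adj_iff_of_lt hpos (Fin.lt_def.2 (by omega))] at hadj
    obtain ⟨k, hik, hkj, hk1, hk2⟩ := exists_frieze_eq_one hij hadj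
      fun p q _ hpq hqj => hpos p q hpq (by omega)
    refine ⟨⟨k, by omega⟩, hik, hkj, ?_, ?_⟩
    · exact (friezeGraph_adj_iff_of_lt hpos hik).2 hk1
    · exact (friezeGraph_adj_iff_of_lt hpos hkj).2 hk2

/-- Counterpart of `IsTriangulation.frieze_of_adj`, with the counts now read off the frieze: when
the triangle `ikj` is glued on, Ptolemy with unit entries adds one at each corner, just as
`card_trianglesIn` does. -/
theorem card_trianglesIn_friezeGraph (hN : 2 ≤ N) {c : ℕ → ℤ}
    (hpos : ∀ i j, i < j → j < N → 0 < frieze c i j) (h0 : frieze c 0 (N - 1) = 1)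
    {i j : Fin N} (hij : i < j) (hadj : (friezeGraph c N).Adj i j) :
    (∀ p : Fin N, i < p → p < j → c p = (trianglesIn (friezeGraph c N) i j p).card) ∧
      frieze c i (j - 1 : ℕ) = (trianglesIn (friezeGraph c N) i j j).card ∧
      frieze c (i + 1) j = (trianglesIn (friezeGraph c N) i j i).card := by
  have hG := isTriangulation_friezeGraph hN hpos h0
  obtain ⟨d, hd⟩ : ∃ d : ℕ, (j : ℕ) - i = d := ⟨_, rfl⟩
  induction d using Nat.strong_induction_on generalizing i j with
  | _ d ih =>
    by_cases hlen : (i : ℕ) + 1 < j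
    · obtain ⟨k, hik, hkj, hGik, hGkj⟩ := hG.exists_triangle hlen hadj
      obtain ⟨a1, a2, a3⟩ := ih (k - i) (by omega) hik hGik rfl
      obtain ⟨b1, b2, b3⟩ := ih (j - k) (by omega) hkj hGkj rfl
      have hcard := card_trianglesIn hG.noncrossing hik hkj hGik hGkj hadj
      have hik' : (i : ℕ) < k := hik
      have hkj' : (k : ℕ) < j := hkj
      rw [friezeGraph_adj_iff_of_lt hpos] at hGik hGkj hadj <;> try assumption
      obtain ⟨l, hl⟩ : ∃ l, (k : ℕ) = l + 1 := ⟨k - 1, by omega⟩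
      obtain ⟨m, hm⟩ : ∃ m, (j : ℕ) = m + 1 := ⟨j - 1, by omega⟩
      have ti : frieze c (i + 1) j = (trianglesIn (friezeGraph c N) i k i).card + 1 := by
        rw [← a3]
        have hp := frieze_ptolemy c i (i + 1) k j
        rw [hGik, hadj, hGkj, frieze_succ] at hp
        linarith
      have tj : frieze c i (j - 1 : ℕ) = (trianglesIn (friezeGraph c N) k j j).card + 1 := by
        rw [← b2, hm, Nat.add_sub_cancel]
        have hp := frieze_ptolemy c i k m (m + 1)
        rw [hm] at hadj hGkj
        rw [hGik, hadj, hGkj, frieze_succ] at hp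
        linarith
      have tk : c k = (trianglesIn (friezeGraph c N) i k k).card +
          (trianglesIn (friezeGraph c N) k j k).card + 1 := by
        rw [← a2, ← b3]
        have hp := frieze_ptolemy c i k (k + 1) j
        rw [hGik, hadj, hGkj, frieze_succ] at hp
        have hr := frieze_right c i l
        rw [show l + 2 = (k : ℕ) + 1 by omega, ← hl, hGik] at hr
        rw [hl, Nat.add_sub_cancel, ← hl]
        linarith
      refine ⟨fun p hip hpj => ?_, ?_, ?_⟩
      · rw [hcard]
        rcases lt_trichotomy p k with h | rfl | h
        · rw [trianglesIn_of_notMem (Or.inl h), a1 p hip h]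
          simp [hip.ne', h.ne, hpj.ne]
        · rw [tk]; simp
        · rw [trianglesIn_of_notMem (i := i) (Or.inr h), b1 p h hpj]
          simp [hip.ne', h.ne', hpj.ne]
      · rw [hcard, trianglesIn_of_notMem (i := i) (Or.inr hkj), tj]; simp
      · rw [hcard, trianglesIn_of_notMem (Or.inl hik), ti]; simp
    · have hj : (j : ℕ) = i + 1 := by
        have : (i : ℕ) < j := hij
        omega
      refine ⟨fun p hip hpj => ?_, ?_, ?_⟩
      · have h1 : (i : ℕ) < p := hip
        have h2 : (p : ℕ) < j := hpj
        omega
      · rw [trianglesIn_of_val_succ hj.symm, hj]; simp [frieze_self]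
      · rw [trianglesIn_of_val_succ hj.symm, hj]; simp [frieze_self]

theorem quiddity_friezeGraph (hN : 2 ≤ N) {c : ℕ → ℤ}
    (hpos : ∀ i j, i < j → j < N → 0 < frieze c i j) (h1 : frieze c 0 (N - 1) = 1)
    (h2 : frieze c 0 (N - 2) = c (N - 1)) (h3 : frieze c 1 (N - 1) = c 0) (v : Fin N) :
    quiddity (friezeGraph c N) v = c v := by
  let i : Fin N := ⟨0, by omega⟩
  let j : Fin N := ⟨N - 1, by omega⟩
  have hj : (j : ℕ) + 1 = N := by simp only [j]; omega
  obtain ⟨a1, a2, a3⟩ := card_trianglesIn_friezeGraph hN hpos h1 (i := i) (j := j)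
    (Fin.lt_def.2 (by simp only [i, j]; omega))
    (adj_zero_last (isTriangulation_friezeGraph hN hpos h1).side rfl hj)
  rw [quiddity_eq_card (i := i) (j := j) rfl hj]
  by_cases hv0 : v = i
  · rw [hv0, ← a3]; simpa [i, j] using h3
  by_cases hvj : v = j
  · rw [hvj, ← a2]
    simp only [i, j, Nat.sub_sub]
    exact h2
  have hv := v.2
  refine (a1 v (Fin.lt_def.2 ?_) (Fin.lt_def.2 ?_)).symm <;>
    simp only [i, j, Fin.ext_iff] at * <;> omega

end triangulation

/-! ### Periodic tuples -/

section tuple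

variable {n : ℕ} [NeZero n] (a : Fin n → ℤ)

/-- The `n`-periodic extension of an `n`-tuple. -/
def periodicExt (k : ℕ) : ℤ := a ⟨k % n, Nat.mod_lt _ (NeZero.pos n)⟩

theorem periodicExt_add (k : ℕ) : periodicExt a (k + n) = periodicExt a k := by
  simp [periodicExt]

theorem periodicExt_val (i : Fin n) : periodicExt a i = a i := by
  simp [periodicExt, Nat.mod_eq_of_lt i.2]

theorem double_eq_periodicExt (v : Fin (2 * n)) : double a v = periodicExt a v := rfl

theorem continuant_window (p m : ℕ) :
    continuant (window a ⟨(p + 1) % n, Nat.mod_lt _ (NeZero.pos n)⟩ m) =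
      frieze (periodicExt a) p (p + m + 1) := by
  rw [← continuant_eq_frieze]
  congr 1
  funext k
  simp [window, periodicExt]

theorem rotundus_eq_trace (hn : 2 ≤ n) :
    rotundus a = recSol (periodicExt a) 0 1 (n + 1) + recSol (periodicExt a) 1 0 n := by
  obtain ⟨M, rfl⟩ : ∃ M, n = M + 2 := ⟨n - 2, by omega⟩
  -- The base point `n - 1` makes the continuant start at position `n`, which is position 0 modulo
  -- the period.
  rw [← frieze_trace_eq (periodicExt_add a) (M + 1), ← continuant_eq_frieze,
    show M + 1 + (M + 2) = M + 1 + 1 + M + 1 by ring, ← continuant_eq_frieze]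
  have e1 : (fun k : Fin (M + 2) => periodicExt a (M + 1 + 1 + k)) = a := by
    funext k
    rw [show M + 1 + 1 + (k : ℕ) = k + (M + 2) by ring, periodicExt_add, periodicExt_val]
  have e2 : (fun k : Fin M => periodicExt a (M + 1 + 1 + 1 + k)) =
      fun k => a k.succ.castSucc := by
    funext k
    rw [show M + 1 + 1 + 1 + (k : ℕ) = (k.succ.castSucc : Fin (M + 2)) + (M + 2) by simp; ring,
      periodicExt_add, periodicExt_val]
  rw [e1, e2]
  rfl

theorem TotallyPositive.frieze_pos {a : Fin n → ℤ} (hn : 2 ≤ n) (ha : TotallyPositive a)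
    (hanti : ∀ i j, frieze (periodicExt a) i (j + 2 * n) = -frieze (periodicExt a) i j)
    (i j : ℕ) (hij : i < j) (hj : j < 2 * n) : 0 < frieze (periodicExt a) i j := by
  have key : ∀ p m : ℕ, m ≤ n + 1 → m ≤ 2 * n - 2 →
      0 < frieze (periodicExt a) p (p + m + 1) := by
    intro p m h1 h2
    rcases Nat.eq_zero_or_pos m with rfl | hm
    · rw [add_zero, frieze_succ]; norm_num
    · rw [← continuant_window]
      exact ha _ m hm h1 h2
  -- Long entries are reflected to short ones: antiperiodicity gives `f(i,j) = f(j, i+2n)`.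
  by_cases h : j - i ≤ n
  · have := key i (j - i - 1) (by omega) (by omega)
    rwa [show i + (j - i - 1) + 1 = j by omega] at this
  · have := key j (2 * n + i - j - 1) (by omega) (by omega)
    rwa [show j + (2 * n + i - j - 1) + 1 = i + 2 * n by omega, hanti, ← frieze_swap] at this

end tuple

/-! ### Central symmetry and the main theorem -/

theorem quiddity_opposite {n : ℕ} {G : SimpleGraph (Fin (2 * n))} (hG : IsCentrallySymmetric G)
    (v : Fin (2 * n)) : quiddity G (opposite v) = quiddity G v := by
  have hinv : Function.Involutive (opposite : Fin (2 * n) → Fin (2 * n)) := by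
    intro v
    apply Fin.ext
    simp only [opposite, Nat.mod_add_mod]
    rw [show (v : ℕ) + n + n = v + 2 * n by ring, Nat.add_mod_right, Nat.mod_eq_of_lt v.2]
  have hcl : ∀ t : Finset (Fin (2 * n)), G.IsNClique 3 t → G.IsNClique 3 (t.image opposite) := by
    intro t ht
    refine ⟨?_, by rw [Finset.card_image_of_injective _ hinv.injective, ht.card_eq]⟩
    intro x hx y hy hxy
    simp only [Finset.coe_image, Set.mem_image, Finset.mem_coe] at hx hy
    obtain ⟨x, hx, rfl⟩ := hx
    obtain ⟨y, hy, rfl⟩ := hy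
    exact (hG x y).1 (ht.isClique hx hy fun h => hxy (by rw [h]))
  have himg : ∀ t : Finset (Fin (2 * n)), (t.image opposite).image opposite = t := by
    intro t
    rw [Finset.image_image, hinv.comp_self, Finset.image_id]
  unfold quiddity
  congr 1
  refine Set.ncard_congr (fun t _ => t.image opposite) ?_ ?_ ?_
  · rintro t ⟨ht, hv⟩
    exact ⟨hcl t ht, Finset.mem_image.2 ⟨_, hv, hinv v⟩⟩
  · intro s t _ _ h
    rw [← himg s, ← himg t]
    exact congrArg _ h
  · rintro t ⟨ht, hv⟩
    exact ⟨t.image opposite, ⟨hcl t ht, Finset.mem_image_of_mem _ hv⟩, himg t⟩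

theorem theorem2 (n : ℕ) (hn : 2 ≤ n) :
    (∀ a : Fin n → ℤ, rotundus a = 0 → TotallyPositive a →
      (∃! G : SimpleGraph (Fin (2 * n)), IsTriangulation G ∧ quiddity G = double a) ∧
      (∀ G : SimpleGraph (Fin (2 * n)), IsTriangulation G → quiddity G = double a →
        IsCentrallySymmetric G)) ∧
    (∀ G : SimpleGraph (Fin (2 * n)), IsTriangulation G → IsCentrallySymmetric G →
      ∃! a : Fin n → ℤ, rotundus a = 0 ∧ TotallyPositive a ∧ quiddity G = double a) := by
  have : NeZero n := ⟨by omega⟩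
  have hdouble : ∀ (a : Fin n → ℤ) (k : ℕ), periodicExt a (k + 2 * n) = periodicExt a k := by
    intro a k
    rw [two_mul, ← add_assoc, periodicExt_add, periodicExt_add]
  refine ⟨fun a hR hpos => ?_, fun G hG hsym => ?_⟩
  · have hc := periodicExt_add a
    have hanti := frieze_antiperiodic_of_trace hc ((rotundus_eq_trace a hn).symm.trans hR)
    have hp := hpos.frieze_pos hn hanti
    have heq : ∀ G : SimpleGraph (Fin (2 * n)), IsTriangulation G → quiddity G = double a →
        G = friezeGraph (periodicExt a) (2 * n) := fun G hG hq =>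
      hG.eq_friezeGraph fun v => by rw [hq, double_eq_periodicExt]
    -- The closing entries come from the same reflection, which carries them to entries of index
    -- difference 1 or 2, namely to 1 or to a term of the sequence.
    have h1 : frieze (periodicExt a) 0 (2 * n - 1) = 1 := by
      have h := hanti (2 * n - 1) 0
      rw [← frieze_swap] at h
      rw [← h, ← frieze_succ (periodicExt a) (2 * n - 1)]
      congr 1; omega
    have h2 : frieze (periodicExt a) 0 (2 * n - 2) = periodicExt a (2 * n - 1) := by
      have h := hanti (2 * n - 2) 0
      rw [← frieze_swap] at h
      rw [← h, show 2 * n - 1 = 2 * n - 2 + 1 by omega, ← frieze_succ_succ (periodicExt a)]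
      congr 1; omega
    have h3 : frieze (periodicExt a) 1 (2 * n - 1) = periodicExt a 0 := by
      have h := hanti (2 * n - 1) 1
      rw [← frieze_swap] at h
      rw [← h, ← hdouble a 0, show 0 + 2 * n = 2 * n - 1 + 1 by omega,
        ← frieze_succ_succ (periodicExt a)]
      congr 1; omega
    refine ⟨⟨friezeGraph (periodicExt a) (2 * n),
      ⟨isTriangulation_friezeGraph (by omega) hp h1, ?_⟩, fun G hG => heq G hG.1 hG.2⟩, ?_⟩
    · funext v
      rw [quiddity_friezeGraph (by omega) hp h1 h2 h3, double_eq_periodicExt]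
    · intro G hG hq u v
      rw [heq G hG hq, friezeGraph_adj_iff, friezeGraph_adj_iff]
      -- `opposite v` is `v + n` up to a shift by `2n`, and the resulting sign disappears in the
      -- absolute value.
      have hopp : ∀ (x : ℕ) (v : Fin (2 * n)),
          |frieze (periodicExt a) x (opposite v : Fin (2 * n))| =
            |frieze (periodicExt a) x (v + n)| := by
        intro x v
        simp only [opposite]
        by_cases hv : (v : ℕ) + n < 2 * n
        · rw [Nat.mod_eq_of_lt hv]
        · obtain ⟨w, hw⟩ := Nat.exists_eq_add_of_le' (not_lt.1 hv)
          rw [hw, Nat.add_mod_right, Nat.mod_eq_of_lt (by omega), hanti, abs_neg]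
      rw [hopp, frieze_swap _ (v + n : ℕ), abs_neg, hopp, frieze_swap _ (u + n : ℕ), abs_neg,
        frieze_shift hc]
  · let a : Fin n → ℤ := fun i => quiddity G ⟨i, by omega⟩
    have hq : quiddity G = double a := by
      funext v
      by_cases hv : (v : ℕ) < n
      · simp only [double, a]
        congr 1
        exact Fin.ext (Nat.mod_eq_of_lt hv).symm
      · rw [← quiddity_opposite hsym]
        simp only [double, a]
        congr 1
        apply Fin.ext
        obtain ⟨w, hw⟩ := Nat.exists_eq_add_of_le' (not_lt.1 hv)
        simp only [opposite]
        rw [hw, show w + n + n = w + 2 * n by ring, Nat.add_mod_right, Nat.add_mod_right,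
          Nat.mod_eq_of_lt (show w < n by omega), Nat.mod_eq_of_lt (by omega)]
    have hc : ∀ v : Fin (2 * n), periodicExt a v = quiddity G v := fun v => by
      rw [hq, double_eq_periodicExt]
    have hlast : ((⟨2 * n - 1, by omega⟩ : Fin (2 * n)) : ℕ) + 1 = 2 * n := by
      simp only; omega
    obtain ⟨h1, h2, h3⟩ := hG.frieze_of_adj hc (i := ⟨0, by omega⟩) (j := ⟨2 * n - 1, by omega⟩)
      (Fin.lt_def.2 (by simp only; omega)) (adj_zero_last hG.side rfl hlast)
    rw [← quiddity_eq_card rfl hlast, ← hc] at h2 h3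
    have hanti := frieze_antiperiodic_of_closing (by omega) (hdouble a) h1 h2 h3
    refine ⟨a, ⟨?_, ?_, hq⟩, ?_⟩
    · rw [rotundus_eq_trace a hn]
      exact trace_eq_zero_of_antiperiodic (periodicExt_add a) hanti
    · intro i m _ _ hm
      -- A window starting at `i` corresponds to the frieze row `i - 1`; adding `n` avoids truncated
      -- subtraction at `i = 0`. The bound `m ≤ 2n - 2` keeps the entry strictly before the next
      -- zero diagonal.
      have hw := continuant_window a (i + n - 1) m
      have e : (⟨(i + n - 1 + 1) % n, Nat.mod_lt _ (NeZero.pos n)⟩ : Fin n) = i := by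
        apply Fin.ext
        simp only
        rw [show (i : ℕ) + n - 1 + 1 = i + n by omega, Nat.add_mod_right, Nat.mod_eq_of_lt i.2]
      rw [e] at hw
      rw [hw]
      exact frieze_pos_of_antiperiodic hanti (fun i j => hG.frieze_pos hc) _ _ (by omega)
        (by omega)
    · rintro b ⟨-, -, hb⟩
      funext i
      rw [← periodicExt_val b i, ← periodicExt_val a i]
      have h := congrFun (hb.symm.trans hq) ⟨i, by omega⟩
      exact h
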